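/- Let $\mathbb K=\mathbb R$ or $\mathbb C$, and let $\ell_1$ be the Banach space of absolutely summable sequences $x=(x_1,x_2,\ldots)$ in $\mathbb K$ with the norm $\|x\|=\sum_i|x_i|$. Let $\omega=(1,\frac1{2^2},\frac1{3^2},\ldots)$, that is $\omega_i=\frac{1}{i^2}$ for $i\ge 1$, and let $B_\omega:\ell_1\to\ell_1$ be the weighted backward shift $[B_\omega(x)]_i=\omega_i x_{i+1}$. Then the continuous bilinear operator $M:\ell_1\times\ell_1\to\ell_1$, $M(x,y)=y_1\,B_\omega(x)$, is hypercyclic: there are $x,y\in\ell_1$ such that the orbit $\{x_n: n\ge -1\}$, defined by $x_{-1}=x$, $x_0=y$ and $x_{n+1}=M(x_{n-1},x_n)$ for $n\ge 0$, is dense in $\ell_1$. -/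

import Mathlib

open scoped ENNReal

noncomputable section

/-- The bilinear orbit with initial conditions `(x, y)`: the sequence
`x, y, M(x, y), M(y, M(x, y)), …`, where each new term is `M` applied to the two preceding
terms, the older one in the first slot. Index `k` here is index `k - 1` in the usual
numbering `x₋₁ = x, x₀ = y, xₙ₊₁ = M(xₙ₋₁, xₙ)`. -/
def bilinearOrbit {𝕜 X : Type*} [NontriviallyNormedField 𝕜] [NormedAddCommGroup X]
    [NormedSpace 𝕜 X] (M : X →L[𝕜] X →L[𝕜] X) (x y : X) : ℕ → X
  | 0 => x
  | 1 => y
  | n + 2 => M (bilinearOrbit M x y n) (bilinearOrbit M x y (n + 1))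

/-- A continuous bilinear operator `M` on `X` is hypercyclic if the orbit of some pair of initial
conditions is dense in `X`. -/
def IsBilinearHypercyclic {𝕜 X : Type*} [NontriviallyNormedField 𝕜] [NormedAddCommGroup X]
    [NormedSpace 𝕜 X] (M : X →L[𝕜] X →L[𝕜] X) : Prop :=
  ∃ x y : X, Dense (Set.range (bilinearOrbit M x y))

/-- The space `ℓ₁` of absolutely summable `𝕜`-valued sequences, with the `1`-norm. Sequences are
indexed from `0`, so the `n`-th coordinate (`n ≥ 1`) of `x` is `x (n - 1)`. -/
abbrev EllOne (𝕜 : Type*) [RCLike 𝕜] : Type _ := lp (fun _ : ℕ => 𝕜) 1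

/-- The weights `ω = (1, 1/2², 1/3², …)`, indexed from `0`. -/
def omegaWeight (𝕜 : Type*) [RCLike 𝕜] (i : ℕ) : 𝕜 := 1 / ((i : 𝕜) + 1) ^ 2

theorem norm_omegaWeight_le_one (𝕜 : Type*) [RCLike 𝕜] (i : ℕ) : ‖omegaWeight 𝕜 i‖ ≤ 1 := by
  have h : ‖(i : 𝕜) + 1‖ = (i : ℝ) + 1 := by
    have := RCLike.norm_natCast (K := 𝕜) (i + 1)
    push_cast at this
    exact this
  rw [omegaWeight, norm_div, norm_pow, h, norm_one]
  refine div_le_one_of_le₀ ?_ (by positivity)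
  have : (0 : ℝ) ≤ i := Nat.cast_nonneg i
  nlinarith

theorem EllOne.summable_norm {𝕜 : Type*} [RCLike 𝕜] (x : EllOne 𝕜) :
    Summable fun i => ‖x i‖ := by
  simpa using (lp.memℓp x).summable (by simp)

theorem EllOne.norm_eq {𝕜 : Type*} [RCLike 𝕜] (x : EllOne 𝕜) : ‖x‖ = ∑' i, ‖x i‖ := by
  simpa using lp.norm_eq_tsum_rpow (p := 1) (by simp) x

theorem norm_omegaWeight_mul_le {𝕜 : Type*} [RCLike 𝕜] (x : EllOne 𝕜) (i : ℕ) :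
    ‖omegaWeight 𝕜 i * x (i + 1)‖ ≤ ‖x (i + 1)‖ := by
  rw [norm_mul]
  exact mul_le_of_le_one_left (norm_nonneg _) (norm_omegaWeight_le_one 𝕜 i)

theorem summable_omegaWeight_mul {𝕜 : Type*} [RCLike 𝕜] (x : EllOne 𝕜) :
    Summable fun i => ‖omegaWeight 𝕜 i * x (i + 1)‖ :=
  Summable.of_nonneg_of_le (fun _ => norm_nonneg _) (norm_omegaWeight_mul_le x)
    ((summable_nat_add_iff 1).2 x.summable_norm)

/-- The weighted backward shift `B_ω : ℓ₁ → ℓ₁`, `[B_ω x]_i = ω_i x_{i+1}`. -/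
def weightedShift (𝕜 : Type*) [RCLike 𝕜] : EllOne 𝕜 →L[𝕜] EllOne 𝕜 :=
  LinearMap.mkContinuous
    { toFun := fun x =>
        ⟨fun i => omegaWeight 𝕜 i * x (i + 1),
          memℓp_gen (by simpa using summable_omegaWeight_mul x)⟩
      map_add' := fun x y => by
        ext i
        simp [mul_add]
        rfl
      map_smul' := fun c x => by
        ext i
        simp [mul_left_comm] }
    1
    (fun x => by
      rw [one_mul, EllOne.norm_eq, EllOne.norm_eq, x.summable_norm.tsum_eq_zero_add]
      exact ((summable_omegaWeight_mul x).tsum_le_tsum (norm_omegaWeight_mul_le x)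
        ((summable_nat_add_iff 1).2 x.summable_norm)).trans
        (le_add_of_nonneg_left (norm_nonneg _)))

theorem weightedShift_apply {𝕜 : Type*} [RCLike 𝕜] (x : EllOne 𝕜) (i : ℕ) :
    weightedShift 𝕜 x i = 1 / ((i : 𝕜) + 1) ^ 2 * x (i + 1) := rfl

/-- The continuous bilinear operator `M(x, y) = e₁'(y) B_ω(x)` on `ℓ₁`, where `e₁'` is the first
coordinate functional. -/
def shiftBilinear (𝕜 : Type*) [RCLike 𝕜] : EllOne 𝕜 →L[𝕜] EllOne 𝕜 →L[𝕜] EllOne 𝕜 :=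
  (ContinuousLinearMap.lsmul 𝕜 𝕜).flip.bilinearComp (weightedShift 𝕜)
    (lp.evalCLM 𝕜 (fun _ : ℕ => 𝕜) (p := 1) 0)

theorem shiftBilinear_apply {𝕜 : Type*} [RCLike 𝕜] (x y : EllOne 𝕜) :
    shiftBilinear 𝕜 x y = y 0 • weightedShift 𝕜 x := rfl

end

/-! Write `P k` for `coordProd x k` and `B` for the shift. The first coordinate of `B ^ k z` is `z k
/ (k!) ^ 2`. Choosing `y k = (k!) ^ 2 (k + 1) ^ 11 / P k` therefore decouples the recursion: the
even-indexed terms are `(k!) ^ 11 • B ^ k x` and the odd-indexed ones `P k • B ^ k y`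
(`bilinearOrbit_shiftBilinear`). It remains to find `x` for which the even terms are dense and `y`
is summable.

Summability of `y` follows from `‖P k‖ ≥ (k!) ^ 3`, a closed condition on `x`, so the Baire category
theorem applies inside `growthSet`. The density it needs is `exists_near`: replace a far tail of `x`
by `smallCoord`, then overwrite it from position `k` on with a preimage of a finitely supported `u`
under `(k!) ^ 11 B ^ k`. For large `k` this preimage is tiny, the leftover tail contributes little
to the image, and the surplus growth of `smallCoord` keeps the point in `growthSet`. -/

open Filter Topology Finset
open scoped Nat ENNReal

noncomputable section

/-! ### Coordinates, separability and finitely supported approximation in `ℓ₁`. -/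

namespace EllOne

variable {𝕜 : Type*} [RCLike 𝕜]

/-- The element of `ℓ₁` with prescribed absolutely summable coordinates. -/
def ofSummable (f : ℕ → 𝕜) (hf : Summable fun i => ‖f i‖) : EllOne 𝕜 :=
  ⟨f, memℓp_gen (by simpa using hf)⟩

theorem norm_le_tsum {x : EllOne 𝕜} {g : ℕ → ℝ} (hg : Summable g) (h : ∀ i, ‖x i‖ ≤ g i) :
    ‖x‖ ≤ ∑' i, g i := by
  rw [norm_eq]
  exact x.summable_norm.tsum_le_tsum h hg

theorem norm_le_tsum_of_shift {x : EllOne 𝕜} {k : ℕ} (hx : ∀ i < k, x i = 0) {g : ℕ → ℝ}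
    (hg : Summable g) (h : ∀ i, ‖x (k + i)‖ ≤ g i) : ‖x‖ ≤ ∑' i, g i := by
  rw [norm_eq, ← x.summable_norm.sum_add_tsum_nat_add k,
    sum_eq_zero fun i hi => by rw [hx i (mem_range.1 hi), norm_zero], zero_add]
  exact ((summable_nat_add_iff k).2 x.summable_norm).tsum_le_tsum
    (fun i => by rw [add_comm]; exact h i) hg

/-- A sequence that is eventually dominated by a summable one is absolutely summable. -/
theorem summable_norm_of_eventually_le {f : ℕ → 𝕜} {g : ℕ → ℝ} (hg : Summable g) (N : ℕ)
    (h : ∀ i, N ≤ i → ‖f i‖ ≤ g i) : Summable fun i => ‖f i‖ :=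
  (summable_nat_add_iff N).1 <| Summable.of_nonneg_of_le (fun _ => norm_nonneg _)
    (fun i => h (i + N) (by omega)) ((summable_nat_add_iff N).2 hg)

theorem continuous_apply (i : ℕ) : Continuous fun x : EllOne 𝕜 => x i :=
  (lp.evalCLM 𝕜 (fun _ : ℕ => 𝕜) (p := 1) i).continuous

theorem tendsto_sum_single (x : EllOne 𝕜) :
    Tendsto (fun n => ∑ i ∈ range n, (lp.single 1 i (x i) : EllOne 𝕜)) atTop (𝓝 x) :=
  (lp.hasSum_single ENNReal.one_ne_top x).tendsto_sum_nat

instance : TopologicalSpace.SeparableSpace (EllOne 𝕜) := by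
  rw [← TopologicalSpace.isSeparable_univ_iff]
  have h : ∀ n : ℕ, TopologicalSpace.IsSeparable
      (Set.range fun c : Fin n → 𝕜 => ∑ i : Fin n, (lp.single 1 (i : ℕ) (c i) : EllOne 𝕜)) := fun n =>
    TopologicalSpace.isSeparable_range <| continuous_finsetSum _ fun i _ =>
      (lp.isometry_single (E := fun _ : ℕ => 𝕜) (i : ℕ)).continuous.comp (_root_.continuous_apply i)
  refine (TopologicalSpace.IsSeparable.iUnion h).closure.mono fun x _ => ?_
  refine mem_closure_of_tendsto (tendsto_sum_single x) (Eventually.of_forall fun n => ?_)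
  exact Set.mem_iUnion.2 ⟨n, fun i => x i, (Finset.sum_range fun i => (lp.single 1 i (x i) : EllOne 𝕜)).symm⟩

theorem sum_single_apply (x : EllOne 𝕜) (n j : ℕ) :
    (∑ i ∈ range n, (lp.single 1 i (x i) : EllOne 𝕜)) j = if j < n then x j else 0 := by
  rw [lp.coeFn_sum, Finset.sum_apply]
  simp

/-- Finitely supported sequences with nonzero first coordinate are dense in `ℓ₁`. -/
theorem exists_finite_support_near (v : EllOne 𝕜) {ε : ℝ} (hε : 0 < ε) :
    ∃ u : EllOne 𝕜, ‖u - v‖ < ε ∧ u 0 ≠ 0 ∧ ∃ m, ∀ i, m ≤ i → u i = 0 := by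
  obtain ⟨n, hn⟩ := (((tendsto_iff_norm_sub_tendsto_zero.1 (tendsto_sum_single v)).eventually
    (gt_mem_nhds (half_pos hε)))).exists
  obtain ⟨η, hη, hη0⟩ : ∃ η : 𝕜, ‖η‖ < ε / 2 ∧
      (∑ i ∈ range n, (lp.single 1 i (v i) : EllOne 𝕜)) 0 + η ≠ 0 := by
    by_cases h : (∑ i ∈ range n, (lp.single 1 i (v i) : EllOne 𝕜)) 0 = 0
    · refine ⟨((ε / 4 : ℝ) : 𝕜), ?_, ?_⟩
      · rw [RCLike.norm_ofReal, abs_of_pos (by positivity)]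
        linarith
      · rw [h, zero_add]
        exact_mod_cast (by positivity : ε / 4 ≠ 0)
    · exact ⟨0, by simpa using hε, by simpa using h⟩
  refine ⟨(∑ i ∈ range n, lp.single 1 i (v i)) + lp.single 1 0 η, ?_, ?_, n + 1, fun i hi => ?_⟩
  · rw [add_sub_right_comm]
    refine (norm_add_le _ _).trans_lt ?_
    rw [lp.norm_single one_pos]
    linarith
  · rw [lp.coeFn_add, Pi.add_apply, lp.single_apply_self]
    exact hη0
  · rw [lp.coeFn_add, Pi.add_apply, sum_single_apply, if_neg (by omega),
      lp.single_apply_ne _ _ _ (by omega), add_zero]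

end EllOne

/-! ### Closed form of the orbit. -/

section Orbit

variable {𝕜 : Type*} [RCLike 𝕜]

theorem weightedShift_pow_apply (k : ℕ) (x : EllOne 𝕜) (i : ℕ) :
    (weightedShift 𝕜 ^ k) x i = (i ! : 𝕜) ^ 2 / ((k + i)! : 𝕜) ^ 2 * x (k + i) := by
  induction k generalizing i with
  | zero =>
    have : (i ! : 𝕜) ≠ 0 := by exact_mod_cast i.factorial_ne_zero
    simp [this]
  | succ k ih =>
    rw [pow_succ', mul_apply_eq_comp, weightedShift_apply, ih,
      show k + (i + 1) = k + 1 + i by ring, ← mul_assoc]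
    congr 1
    have h1 : (i ! : 𝕜) ≠ 0 := by exact_mod_cast i.factorial_ne_zero
    have h2 : ((k + 1 + i)! : 𝕜) ≠ 0 := by exact_mod_cast Nat.factorial_ne_zero _
    have h3 : (i : 𝕜) + 1 ≠ 0 := by exact_mod_cast i.succ_ne_zero
    rw [Nat.factorial_succ i]
    push_cast
    field_simp

/-- The product `∏_{1 ≤ i ≤ k} (i!)⁹ xᵢ`: the scalar in front of the `k`-th power of the shift in
the odd-indexed terms of the orbit. -/
def coordProd (x : EllOne 𝕜) (k : ℕ) : 𝕜 :=
  ∏ i ∈ range k, ((i + 1)! : 𝕜) ^ 9 * x (i + 1)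

@[simp]
theorem coordProd_zero (x : EllOne 𝕜) : coordProd x 0 = 1 := by simp [coordProd]

theorem coordProd_succ (x : EllOne 𝕜) (k : ℕ) :
    coordProd x (k + 1) = coordProd x k * (((k + 1)! : 𝕜) ^ 9 * x (k + 1)) :=
  prod_range_succ _ _

theorem norm_coordProd_succ (x : EllOne 𝕜) (k : ℕ) :
    ‖coordProd x (k + 1)‖ = ‖coordProd x k‖ * (((k + 1)! : ℝ) ^ 9 * ‖x (k + 1)‖) := by
  rw [coordProd_succ, norm_mul, norm_mul, norm_pow, RCLike.norm_natCast]

theorem coordProd_congr {x y : EllOne 𝕜} {k : ℕ} (h : ∀ i ≤ k, x i = y i) :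
    coordProd x k = coordProd y k :=
  prod_congr rfl fun i hi => by rw [h _ (by simpa [Nat.succ_le_iff] using hi)]

theorem continuous_coordProd (k : ℕ) : Continuous fun x : EllOne 𝕜 => coordProd x k :=
  continuous_finsetProd _ fun i _ => continuous_const.mul (EllOne.continuous_apply (i + 1))

/-- The first coordinate of the odd term is `(k + 1) ^ 11`, which turns `(k!) ^ 11` into `((k + 1)!)
^ 11`. The first coordinate of the next even term is `((k + 1)!) ^ (11 - 2) * x (k + 1)`, the new
factor of `coordProd`. -/
theorem bilinearOrbit_shiftBilinear {x y : EllOne 𝕜} (hx : ∀ k, coordProd x k ≠ 0)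
    (hy : ∀ k : ℕ, y k = (k ! : 𝕜) ^ 2 * ((k : 𝕜) + 1) ^ 11 / coordProd x k) (k : ℕ) :
    bilinearOrbit (shiftBilinear 𝕜) x y (2 * k) = (k ! : 𝕜) ^ 11 • (weightedShift 𝕜 ^ k) x ∧
      bilinearOrbit (shiftBilinear 𝕜) x y (2 * k + 1) =
        coordProd x k • (weightedShift 𝕜 ^ k) y := by
  induction k with
  | zero => simp [bilinearOrbit]
  | succ k ih =>
    have h1 : ∀ k : ℕ, (k ! : 𝕜) ≠ 0 := fun k => by exact_mod_cast k.factorial_ne_zero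
    have even : bilinearOrbit (shiftBilinear 𝕜) x y (2 * (k + 1)) =
        ((k + 1)! : 𝕜) ^ 11 • (weightedShift 𝕜 ^ (k + 1)) x := by
      rw [show 2 * (k + 1) = 2 * k + 2 by ring, bilinearOrbit, ih.1, ih.2, shiftBilinear_apply,
        map_smul, smul_smul, pow_succ' (weightedShift 𝕜), mul_apply_eq_comp]
      congr 1
      rw [lp.coeFn_smul, Pi.smul_apply, weightedShift_pow_apply, add_zero, hy, Nat.factorial_succ]
      have := hx k
      have := h1 k
      simp only [smul_eq_mul, Nat.factorial_zero]
      push_cast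
      field_simp
    refine ⟨even, ?_⟩
    rw [show 2 * (k + 1) + 1 = 2 * k + 1 + 2 by ring, bilinearOrbit,
      show 2 * k + 1 + 1 = 2 * (k + 1) by ring, even, ih.2, shiftBilinear_apply,
      map_smul, smul_smul, pow_succ' (weightedShift 𝕜), mul_apply_eq_comp,
      ← mul_apply_eq_comp, ← pow_succ' (weightedShift 𝕜),
      ← mul_apply_eq_comp, ← pow_succ' (weightedShift 𝕜)]
    congr 1
    rw [lp.coeFn_smul, Pi.smul_apply, weightedShift_pow_apply, add_zero, coordProd_succ]
    have := h1 (k + 1)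
    simp only [smul_eq_mul, Nat.factorial_zero]
    field_simp
    simp

end Orbit

/-! ### The growth set, and estimates for the two kinds of inserted coordinates. -/

section Perturbation

variable {𝕜 : Type*} [RCLike 𝕜]

/-- The set of `x ∈ ℓ₁` whose coordinate products grow at least like `(k!)³`. -/
def growthSet (𝕜 : Type*) [RCLike 𝕜] : Set (EllOne 𝕜) :=
  {x | ∀ k : ℕ, (k ! : ℝ) ^ 3 ≤ ‖coordProd x k‖}

theorem isClosed_growthSet : IsClosed (growthSet 𝕜) := by
  rw [growthSet, Set.ofPred_forall]
  exact isClosed_iInter fun k => isClosed_le continuous_const (continuous_coordProd k).norm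

theorem one_le_factorial_cast (k : ℕ) : (1 : ℝ) ≤ k ! := by
  exact_mod_cast k.factorial_pos

theorem coordProd_ne_zero {x : EllOne 𝕜} (hx : x ∈ growthSet 𝕜) (k : ℕ) : coordProd x k ≠ 0 := by
  rw [← norm_pos_iff]
  refine lt_of_lt_of_le ?_ (hx k)
  have := one_le_factorial_cast k
  positivity

theorem growth_succ {x : EllOne 𝕜} {n : ℕ} (hn : (n ! : ℝ) ^ 3 ≤ ‖coordProd x n‖)
    (h : ((n + 1 : ℕ) : ℝ) ^ 3 ≤ ((n + 1)! : ℝ) ^ 9 * ‖x (n + 1)‖) :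
    ((n + 1)! : ℝ) ^ 3 ≤ ‖coordProd x (n + 1)‖ := by
  rw [norm_coordProd_succ, Nat.factorial_succ, Nat.cast_mul, mul_pow, mul_comm]
  rw [Nat.factorial_succ, Nat.cast_mul] at h
  gcongr

/-- The coordinates of a particular element of the growth set. -/
def smallCoord (𝕜 : Type*) [RCLike 𝕜] (j : ℕ) : 𝕜 := (j : 𝕜) ^ 7 / (j ! : 𝕜) ^ 9

theorem norm_smallCoord (j : ℕ) : ‖smallCoord 𝕜 j‖ = (j : ℝ) ^ 7 / (j ! : ℝ) ^ 9 := by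
  simp [smallCoord]

theorem norm_smallCoord_le (j : ℕ) : ‖smallCoord 𝕜 j‖ ≤ 1 / j ! := by
  have h1 := one_le_factorial_cast j
  have h2 : (j : ℝ) ≤ j ! := by exact_mod_cast j.self_le_factorial
  rw [norm_smallCoord, div_le_div_iff₀ (by positivity) (by positivity), one_mul]
  calc (j : ℝ) ^ 7 * j ! ≤ (j ! : ℝ) ^ 7 * j ! := by gcongr
    _ = (j ! : ℝ) ^ 8 := by ring
    _ ≤ (j ! : ℝ) ^ 9 := pow_le_pow_right₀ h1 (by norm_num)

/-- Growth needs only a factor `j ^ 3`. The surplus `j ^ 4` pays for one later factor that may be as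
small as `‖u 0‖`. -/
theorem factorial_pow_mul_norm_smallCoord (j : ℕ) :
    (j ! : ℝ) ^ 9 * ‖smallCoord 𝕜 j‖ = (j : ℝ) ^ 7 := by
  have := one_le_factorial_cast j
  rw [norm_smallCoord]
  field_simp

theorem summable_one_div_factorial : Summable fun i : ℕ => 1 / (i ! : ℝ) := by
  simpa using Real.summable_pow_div_factorial 1

theorem pow_three_le_of_smallCoord {x : EllOne 𝕜} {n : ℕ}
    (h : x (n + 1) = smallCoord 𝕜 (n + 1)) :
    ((n + 1 : ℕ) : ℝ) ^ 3 ≤ ((n + 1)! : ℝ) ^ 9 * ‖x (n + 1)‖ := by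
  rw [h, factorial_pow_mul_norm_smallCoord]
  exact pow_le_pow_right₀ (by exact_mod_cast Nat.le_add_left 1 n) (by norm_num)

theorem growthSet_nonempty : (growthSet 𝕜).Nonempty := by
  refine ⟨EllOne.ofSummable (smallCoord 𝕜) (EllOne.summable_norm_of_eventually_le
    summable_one_div_factorial 0 fun i _ => norm_smallCoord_le i), fun k => ?_⟩
  induction k with
  | zero => simp
  | succ n ih => exact growth_succ ih (pow_three_le_of_smallCoord rfl)

/-- Elements of the growth set that agree with `smallCoord` from some index on are dense in it. -/
theorem exists_eventually_smallCoord {x : EllOne 𝕜} (hx : x ∈ growthSet 𝕜) {ε : ℝ} (hε : 0 < ε) :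
    ∃ x' ∈ growthSet 𝕜, ‖x' - x‖ < ε ∧ ∃ N, ∀ j, N ≤ j → x' j = smallCoord 𝕜 j := by
  have hg : Summable fun i : ℕ => 1 / (i ! : ℝ) + ‖x i‖ :=
    summable_one_div_factorial.add x.summable_norm
  obtain ⟨N, hN⟩ := ((tendsto_sum_nat_add fun i : ℕ => 1 / (i ! : ℝ) + ‖x i‖).eventually
    (gt_mem_nhds hε)).exists
  let x' : EllOne 𝕜 := EllOne.ofSummable (fun j => if j < N then x j else smallCoord 𝕜 j)
    (EllOne.summable_norm_of_eventually_le summable_one_div_factorial N fun i hi => by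
      rw [if_neg (by omega)]; exact norm_smallCoord_le i)
  have h1 : ∀ j < N, x' j = x j := fun j hj => if_pos hj
  have h2 : ∀ j, N ≤ j → x' j = smallCoord 𝕜 j := fun j hj => if_neg (by omega)
  refine ⟨x', fun n => ?_, lt_of_le_of_lt ?_ hN, N, h2⟩
  · induction n with
    | zero => simp
    | succ n ih =>
      rcases lt_or_ge (n + 1) N with h | h
      · rw [coordProd_congr fun i hi => h1 i (by omega)]
        exact hx _
      · exact growth_succ ih (pow_three_le_of_smallCoord (h2 _ h))
  · refine EllOne.norm_le_tsum_of_shift (k := N) (fun i hi => ?_)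
      ((summable_nat_add_iff N).2 hg) fun i => ?_
    · rw [lp.coeFn_sub, Pi.sub_apply, h1 i hi, sub_self]
    · rw [lp.coeFn_sub, Pi.sub_apply, h2 _ (by omega), add_comm N i]
      exact (norm_sub_le _ _).trans (add_le_add_left (norm_smallCoord_le _) _)

/-- The `i`-th coordinate of the preimage of `u` under `(k!)¹¹ B_ω ^ k`, shifted by `k`. -/
def liftCoord (u : EllOne 𝕜) (k i : ℕ) : 𝕜 :=
  u i * ((k + i)! : 𝕜) ^ 2 / ((i ! : 𝕜) ^ 2 * (k ! : 𝕜) ^ 11)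

theorem norm_liftCoord (u : EllOne 𝕜) (k i : ℕ) :
    ‖liftCoord u k i‖ = ‖u i‖ * ((k + i)! : ℝ) ^ 2 / ((i ! : ℝ) ^ 2 * (k ! : ℝ) ^ 11) := by
  simp [liftCoord]

/-- The bound `(k + i).choose i ≤ 2 ^ (k + i)` controls the factorial quotient, and the finite
support of `u` makes the bound uniform in `i`. -/
theorem norm_liftCoord_le (u : EllOne 𝕜) {m : ℕ} (hu : ∀ i, m ≤ i → u i = 0) (k i : ℕ) :
    ‖liftCoord u k i‖ ≤ ‖u i‖ * (4 ^ m * (4 ^ k / k !)) := by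
  rcases le_or_gt m i with h | h
  · simp [norm_liftCoord, hu i h]
  have h1 := one_le_factorial_cast k
  have h2 := one_le_factorial_cast i
  have h3 : ((k + i)! : ℝ) ≤ 2 ^ (k + i) * k ! * i ! := by
    rw [← Nat.add_choose_mul_factorial_mul_factorial k i]
    push_cast
    gcongr
    exact_mod_cast Nat.choose_le_two_pow (k + i) i
  rw [norm_liftCoord, mul_div_assoc]
  gcongr
  rw [div_le_iff₀ (by positivity)]
  calc ((k + i)! : ℝ) ^ 2 ≤ (2 ^ (k + i) * k ! * i !) ^ 2 := by gcongr
    _ = 4 ^ i * 4 ^ k * (i ! : ℝ) ^ 2 * (k ! : ℝ) ^ 2 := by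
      rw [show (4 : ℝ) = 2 ^ 2 by norm_num, ← pow_mul, ← pow_mul]; ring
    _ ≤ 4 ^ m * 4 ^ k * (i ! : ℝ) ^ 2 * (k ! : ℝ) ^ 10 := by
      gcongr
      · norm_num
      · norm_num
    _ = 4 ^ m * (4 ^ k / k !) * ((i ! : ℝ) ^ 2 * (k ! : ℝ) ^ 11) := by
      field_simp

theorem factorial_mul_factorial_le_cast (k i : ℕ) : (k ! : ℝ) * i ! ≤ (k + i)! := by
  exact_mod_cast Nat.le_of_dvd (Nat.factorial_pos _) (Nat.factorial_mul_factorial_dvd_factorial_add k i)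

theorem add_mul_factorial_le_cast (k : ℕ) {i : ℕ} (hi : i ≠ 0) :
    ((k + i : ℕ) : ℝ) * k ! ≤ (k + i)! := by
  obtain ⟨i, rfl⟩ := Nat.exists_eq_succ_of_ne_zero hi
  rw [Nat.succ_eq_add_one, ← add_assoc, Nat.factorial_succ]
  exact_mod_cast Nat.mul_le_mul_left _ (Nat.factorial_le (Nat.le_add_right k i))

/-- With `P = (k + i)! / k!` the powers of `k!` cancel and the right side is `‖u i‖ P ^ 11 / (i!) ^
2`, where `P` dominates `k + i` and `i!`. For `i = 0` it is only `‖u 0‖`. -/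
theorem pow_three_le_of_liftCoord {u : EllOne 𝕜} {k i : ℕ} (hi : i ≠ 0) (hk : 1 ≤ ‖u i‖ * k) :
    ((k + i : ℕ) : ℝ) ^ 3 ≤ ((k + i)! : ℝ) ^ 9 * ‖liftCoord u k i‖ := by
  have h1 := one_le_factorial_cast k
  have h2 := one_le_factorial_cast i
  obtain ⟨P, hP⟩ : ∃ P : ℝ, ((k + i)! : ℝ) = k ! * P := ⟨(k + i)! / k !, by field_simp⟩
  have h3 := factorial_mul_factorial_le_cast k i
  have h4 := add_mul_factorial_le_cast k hi
  rw [hP] at h3 h4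
  replace h3 : (i ! : ℝ) ≤ P := le_of_mul_le_mul_left h3 (by positivity)
  replace h4 : ((k + i : ℕ) : ℝ) ≤ P := by
    rw [mul_comm] at h4; exact le_of_mul_le_mul_left h4 (by positivity)
  have hP1 : 1 ≤ P := h2.trans h3
  have hkP : (k : ℝ) ≤ P := le_trans (by push_cast; linarith [(Nat.cast_nonneg i : (0 : ℝ) ≤ i)]) h4
  have key : ((k ! : ℝ) * P) ^ 9 * (‖u i‖ * (k ! * P) ^ 2 / ((i ! : ℝ) ^ 2 * (k ! : ℝ) ^ 11)) =
      ‖u i‖ * P ^ 11 / (i ! : ℝ) ^ 2 := by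
    field_simp
  rw [norm_liftCoord, hP, key, le_div_iff₀ (by positivity)]
  calc ((k + i : ℕ) : ℝ) ^ 3 * (i ! : ℝ) ^ 2 ≤ P ^ 3 * P ^ 2 := by gcongr
    _ = 1 * P ^ 5 := by ring
    _ ≤ ‖u i‖ * k * P ^ 5 := by gcongr
    _ ≤ ‖u i‖ * P * P ^ 5 := by gcongr
    _ = ‖u i‖ * P ^ 6 := by ring
    _ ≤ ‖u i‖ * P ^ 11 := by
      gcongr
      norm_num

/-- For `i = 0` the left side equals `k ^ 7`; this is why approximants `u` must have `u 0 ≠ 0`, so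
that position `k` is always overwritten. -/
theorem norm_shift_smallCoord_le (k : ℕ) {i : ℕ} (hi : i ≠ 0) :
    (k ! : ℝ) ^ 11 * ((i ! : ℝ) ^ 2 / ((k + i)! : ℝ) ^ 2 * ‖smallCoord 𝕜 (k + i)‖) ≤
      1 / ((k : ℝ) + 1) * (1 / i !) := by
  have h1 := one_le_factorial_cast k
  have h2 := one_le_factorial_cast i
  obtain ⟨P, hP⟩ : ∃ P : ℝ, ((k + i)! : ℝ) = k ! * P := ⟨(k + i)! / k !, by field_simp⟩
  have h3 := factorial_mul_factorial_le_cast k i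
  have h4 := add_mul_factorial_le_cast k hi
  rw [hP] at h3 h4
  replace h3 : (i ! : ℝ) ≤ P := le_of_mul_le_mul_left h3 (by positivity)
  replace h4 : ((k + i : ℕ) : ℝ) ≤ P := by
    rw [mul_comm] at h4; exact le_of_mul_le_mul_left h4 (by positivity)
  have hP1 : 1 ≤ P := h2.trans h3
  have hkP : (k : ℝ) + 1 ≤ P := le_trans (by exact_mod_cast by omega) h4
  have key : (k ! : ℝ) ^ 11 * ((i ! : ℝ) ^ 2 / ((k ! : ℝ) * P) ^ 2 *
      (((k + i : ℕ) : ℝ) ^ 7 / (k ! * P) ^ 9)) = ((k + i : ℕ) : ℝ) ^ 7 * (i ! : ℝ) ^ 2 / P ^ 11 := by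
    field_simp
  rw [norm_smallCoord, hP, key, one_div_mul_one_div, div_le_div_iff₀ (by positivity) (by positivity)]
  calc ((k + i : ℕ) : ℝ) ^ 7 * (i ! : ℝ) ^ 2 * (((k : ℝ) + 1) * i !)
      ≤ P ^ 7 * P ^ 2 * (P * P) := by gcongr
    _ = 1 * P ^ 11 := by ring

end Perturbation

/-! ### Inserting a target far out, and the Baire argument. -/

section Density

variable {𝕜 : Type*} [RCLike 𝕜]

/-- A uniform `c` lets one large `k` compensate for every nonzero coordinate of `u`. -/
theorem exists_pos_lower_bound (u : ℕ → 𝕜) (m : ℕ) (hu : ∀ i, m ≤ i → u i = 0) :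
    ∃ c : ℝ, 0 < c ∧ ∀ i, u i ≠ 0 → c ≤ ‖u i‖ := by
  have h : ∀ n : ℕ, ∃ c : ℝ, 0 < c ∧ ∀ i < n, u i ≠ 0 → c ≤ ‖u i‖ := by
    intro n
    induction n with
    | zero => exact ⟨1, one_pos, by simp⟩
    | succ n ih =>
      obtain ⟨c, hc, h⟩ := ih
      by_cases hn : u n = 0
      · refine ⟨c, hc, fun i hi hui => h i ?_ hui⟩
        rcases Nat.lt_succ_iff_lt_or_eq.1 hi with h | rfl
        exacts [h, absurd hn hui]
      · refine ⟨min c ‖u n‖, lt_min hc (norm_pos_iff.2 hn), fun i hi hui => ?_⟩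
        rcases Nat.lt_succ_iff_lt_or_eq.1 hi with h' | rfl
        exacts [(min_le_left _ _).trans (h i h' hui), min_le_right _ _]
  obtain ⟨c, hc, h⟩ := h m
  exact ⟨c, hc, fun i hui => h i (not_le.1 fun hi => hui (hu i hi)) hui⟩

/-- `x` with the coordinates from `k` on replaced by those of the preimage of `u` under
`(k!)¹¹ B_ω ^ k`, wherever `u` is nonzero. -/
def insertCoord (x u : EllOne 𝕜) (k j : ℕ) : 𝕜 :=
  if k ≤ j ∧ u (j - k) ≠ 0 then liftCoord u k (j - k) else x j

theorem insertCoord_of_lt (x u : EllOne 𝕜) {k j : ℕ} (h : j < k) : insertCoord x u k j = x j :=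
  if_neg fun h' => by omega

theorem insertCoord_add_of_ne (x : EllOne 𝕜) {u : EllOne 𝕜} (k : ℕ) {i : ℕ} (h : u i ≠ 0) :
    insertCoord x u k (k + i) = liftCoord u k i := by
  rw [insertCoord, Nat.add_sub_cancel_left, if_pos ⟨Nat.le_add_right k i, h⟩]

theorem insertCoord_add_of_eq (x : EllOne 𝕜) {u : EllOne 𝕜} (k : ℕ) {i : ℕ} (h : u i = 0) :
    insertCoord x u k (k + i) = x (k + i) := by
  rw [insertCoord, Nat.add_sub_cancel_left, if_neg fun h' => h'.2 h]

theorem summable_insertCoord (x : EllOne 𝕜) {u : EllOne 𝕜} {m : ℕ} (hu : ∀ i, m ≤ i → u i = 0)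
    (k : ℕ) : Summable fun j => ‖insertCoord x u k j‖ := by
  refine EllOne.summable_norm_of_eventually_le x.summable_norm (k + m) fun j hj => ?_
  obtain ⟨i, rfl⟩ := Nat.exists_eq_add_of_le (show k ≤ j by omega)
  rw [insertCoord_add_of_eq x k (hu i (by omega))]

/-- If `x` is in the growth set, then so is the sequence with `u` inserted far out. -/
theorem mem_growthSet_of_insertCoord {x : EllOne 𝕜} (hx : x ∈ growthSet 𝕜) {N : ℕ}
    (hN : ∀ j, N ≤ j → x j = smallCoord 𝕜 j) {u : EllOne 𝕜} (hu0 : u 0 ≠ 0) {c : ℝ} (hc : 0 < c)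
    (huc : ∀ i, u i ≠ 0 → c ≤ ‖u i‖) {k : ℕ} (hk : N + 2 ≤ k) (hck : 16 ≤ c * k)
    {x' : EllOne 𝕜} (hx' : ∀ j, x' j = insertCoord x u k j) : x' ∈ growthSet 𝕜 := by
  have hlt : ∀ n < k, coordProd x' n = coordProd x n := fun n hn =>
    coordProd_congr fun i hi => by rw [hx', insertCoord_of_lt x u (by omega)]
  intro n
  induction n with
  | zero => simp
  | succ n ih =>
    rcases lt_trichotomy (n + 1) k with h | h | h
    · rw [hlt _ h]
      exact hx _
    -- At position `k` the new factor is just `‖u 0‖`, so it is grouped with the preceding factor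
    -- `(k - 1) ^ 7`, where `k = l + 2`.
    · subst h
      obtain ⟨l, rfl⟩ := Nat.exists_eq_add_of_le (show 1 ≤ n by omega)
      rw [add_comm 1 l] at *
      have h1 := one_le_factorial_cast (l + 1 + 1)
      have h2 : ((l + 1 + 1)! : ℝ) ^ 9 * ‖x' (l + 1 + 1)‖ = ‖u 0‖ := by
        rw [hx', show insertCoord x u (l + 1 + 1) (l + 1 + 1) = _ from
          insertCoord_add_of_ne x (l + 1 + 1) hu0, norm_liftCoord]
        simp only [add_zero, Nat.factorial_zero]
        field_simp
        simp
      rw [norm_coordProd_succ, h2, hlt _ (by omega), norm_coordProd_succ, hN _ (by omega),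
        factorial_pow_mul_norm_smallCoord, Nat.factorial_succ (l + 1), Nat.factorial_succ l]
      have h3 := hx l
      have h4 := huc 0 hu0
      -- Passing from `k` to `k - 1 ≥ k / 2` halves the constant 16; the remaining 8 is the `2 ^ 3`
      -- from `k ^ 3 ≤ (2 (k - 1)) ^ 3`.
      have h5 : (8 : ℝ) ≤ ‖u 0‖ * ((l + 1 : ℕ) : ℝ) := by
        push_cast at hck ⊢
        have : (0 : ℝ) ≤ l := Nat.cast_nonneg l
        nlinarith
      have h6 : ((l + 1 + 1 : ℕ) : ℝ) ≤ 2 * ((l + 1 : ℕ) : ℝ) := by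
        push_cast
        linarith [(Nat.cast_nonneg l : (0 : ℝ) ≤ l)]
      have h7 : (0 : ℝ) ≤ ((l + 1 : ℕ) : ℝ) := Nat.cast_nonneg _
      rw [Nat.cast_mul, Nat.cast_mul]
      calc (((l + 1 + 1 : ℕ) : ℝ) * (((l + 1 : ℕ) : ℝ) * l !)) ^ 3
          ≤ (2 * ((l + 1 : ℕ) : ℝ) * (((l + 1 : ℕ) : ℝ) * l !)) ^ 3 := by gcongr
        _ = (l ! : ℝ) ^ 3 * ((l + 1 : ℕ) : ℝ) ^ 6 * 8 := by ring
        _ ≤ ‖coordProd x l‖ * ((l + 1 : ℕ) : ℝ) ^ 6 * (‖u 0‖ * ((l + 1 : ℕ) : ℝ)) := by gcongr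
        _ = ‖coordProd x l‖ * ((l + 1 : ℕ) : ℝ) ^ 7 * ‖u 0‖ := by ring
    · obtain ⟨i, hi⟩ := Nat.exists_eq_add_of_lt h
      refine growth_succ ih ?_
      rw [show n + 1 = k + (i + 1) by omega, hx']
      by_cases hui : u (i + 1) = 0
      · rw [insertCoord_add_of_eq x k hui]
        exact pow_three_le_of_smallCoord (n := k + i) (hN _ (by omega))
      · rw [insertCoord_add_of_ne x k hui]
        refine pow_three_le_of_liftCoord i.succ_ne_zero ?_
        have := huc _ hui
        have : c * k ≤ ‖u (i + 1)‖ * k := by gcongr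
        linarith

theorem norm_sub_le_of_insertCoord {x : EllOne 𝕜} {N : ℕ}
    (hN : ∀ j, N ≤ j → x j = smallCoord 𝕜 j) {u : EllOne 𝕜} {m : ℕ} (hm : ∀ i, m ≤ i → u i = 0)
    {k : ℕ} (hk : N ≤ k) {x' : EllOne 𝕜} (hx' : ∀ j, x' j = insertCoord x u k j) :
    ‖x' - x‖ ≤ ‖u‖ * (4 ^ m * (4 ^ k / k !)) + 1 / k ! * ∑' i : ℕ, 1 / (i ! : ℝ) := by
  rw [EllOne.norm_eq u, ← tsum_mul_right, ← tsum_mul_left,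
    ← (u.summable_norm.mul_right _).tsum_add (summable_one_div_factorial.mul_left _)]
  refine EllOne.norm_le_tsum_of_shift (k := k) (fun i hi => ?_)
    ((u.summable_norm.mul_right _).add (summable_one_div_factorial.mul_left _)) fun i => ?_
  · rw [lp.coeFn_sub, Pi.sub_apply, hx', insertCoord_of_lt x u hi, sub_self]
  · rw [lp.coeFn_sub, Pi.sub_apply, hx']
    by_cases hui : u i = 0
    · rw [insertCoord_add_of_eq x k hui, sub_self, norm_zero]
      positivity
    · rw [insertCoord_add_of_ne x k hui, hN _ (by omega)]
      refine (norm_sub_le _ _).trans (add_le_add (norm_liftCoord_le u hm k i)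
        ((norm_smallCoord_le _).trans ?_))
      have h1 := one_le_factorial_cast k
      have h2 := one_le_factorial_cast i
      rw [one_div_mul_one_div]
      exact one_div_le_one_div_of_le (by positivity) (factorial_mul_factorial_le_cast k i)

theorem norm_shift_sub_le_of_insertCoord {x : EllOne 𝕜} {N : ℕ}
    (hN : ∀ j, N ≤ j → x j = smallCoord 𝕜 j) {u : EllOne 𝕜} (hu0 : u 0 ≠ 0)
    {k : ℕ} (hk : N ≤ k) {x' : EllOne 𝕜} (hx' : ∀ j, x' j = insertCoord x u k j) :
    ‖(k ! : 𝕜) ^ 11 • (weightedShift 𝕜 ^ k) x' - u‖ ≤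
      1 / ((k : ℝ) + 1) * ∑' i : ℕ, 1 / (i ! : ℝ) := by
  rw [← tsum_mul_left]
  refine EllOne.norm_le_tsum (summable_one_div_factorial.mul_left _) fun i => ?_
  rw [lp.coeFn_sub, Pi.sub_apply, lp.coeFn_smul, Pi.smul_apply, weightedShift_pow_apply, hx']
  by_cases hui : u i = 0
  -- Where `u` vanishes `x` keeps its nonzero coordinate, so the image is off by a small amount;
  -- elsewhere it is exact.
  · rw [insertCoord_add_of_eq x k hui, hui, sub_zero, hN _ (by omega)]
    convert norm_shift_smallCoord_le (𝕜 := 𝕜) k (i := i) (by rintro rfl; exact hu0 hui) using 1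
    simp
  · rw [insertCoord_add_of_ne x k hui, liftCoord]
    have h : ∀ k : ℕ, (k ! : 𝕜) ≠ 0 := fun k => by exact_mod_cast k.factorial_ne_zero
    have h1 := h i
    have h2 := h k
    have h3 := h (k + i)
    rw [smul_eq_mul, show (k ! : 𝕜) ^ 11 * ((i ! : 𝕜) ^ 2 / ((k + i)! : 𝕜) ^ 2 *
      (u i * ((k + i)! : 𝕜) ^ 2 / ((i ! : 𝕜) ^ 2 * (k ! : 𝕜) ^ 11))) = u i by field_simp, sub_self,
      norm_zero]
    positivity

theorem exists_near_of_finite_support {x : EllOne 𝕜} (hx : x ∈ growthSet 𝕜) {N : ℕ}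
    (hN : ∀ j, N ≤ j → x j = smallCoord 𝕜 j) {u : EllOne 𝕜} (hu0 : u 0 ≠ 0) {m : ℕ}
    (hm : ∀ i, m ≤ i → u i = 0) {ε : ℝ} (hε : 0 < ε) :
    ∃ x' ∈ growthSet 𝕜, ‖x' - x‖ < ε ∧
      ∃ k : ℕ, ‖(k ! : 𝕜) ^ 11 • (weightedShift 𝕜 ^ k) x' - u‖ < ε := by
  obtain ⟨c, hc, huc⟩ := exists_pos_lower_bound u m hm
  have t1 : Tendsto (fun k : ℕ => ‖u‖ * (4 ^ m * (4 ^ k / (k ! : ℝ))) +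
      1 / (k ! : ℝ) * ∑' i : ℕ, 1 / (i ! : ℝ)) atTop (𝓝 0) := by
    have h4 := FloorSemiring.tendsto_pow_div_factorial_atTop (4 : ℝ)
    have h1 := FloorSemiring.tendsto_pow_div_factorial_atTop (1 : ℝ)
    simp only [one_pow] at h1
    simpa using ((h4.const_mul (4 ^ m)).const_mul ‖u‖).add
      (h1.mul_const (∑' i : ℕ, 1 / (i ! : ℝ)))
  have t2 : Tendsto (fun k : ℕ => 1 / ((k : ℝ) + 1) * ∑' i : ℕ, 1 / (i ! : ℝ)) atTop (𝓝 0) := by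
    simpa using tendsto_one_div_add_atTop_nhds_zero_nat.mul_const (∑' i : ℕ, 1 / (i ! : ℝ))
  have t3 : Tendsto (fun k : ℕ => c * (k : ℝ)) atTop atTop :=
    tendsto_natCast_atTop_atTop.const_mul_atTop hc
  obtain ⟨k, hk1, hk2, hk3, hk4⟩ := ((t1.eventually (gt_mem_nhds hε)).and
    ((t2.eventually (gt_mem_nhds hε)).and
      ((t3.eventually_ge_atTop 16).and (eventually_ge_atTop (N + 2))))).exists
  have hx' : ∀ j, EllOne.ofSummable _ (summable_insertCoord x hm k) j = insertCoord x u k j :=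
    fun _ => rfl
  exact ⟨_, mem_growthSet_of_insertCoord hx hN hu0 hc huc hk4 hk3 hx',
    (norm_sub_le_of_insertCoord hN hm (by omega) hx').trans_lt hk1, k,
    (norm_shift_sub_le_of_insertCoord hN hu0 (by omega) hx').trans_lt hk2⟩

theorem exists_near {x : EllOne 𝕜} (hx : x ∈ growthSet 𝕜) (v : EllOne 𝕜) {ε : ℝ} (hε : 0 < ε) :
    ∃ x' ∈ growthSet 𝕜, ‖x' - x‖ < ε ∧
      ∃ k : ℕ, ‖(k ! : 𝕜) ^ 11 • (weightedShift 𝕜 ^ k) x' - v‖ < ε := by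
  obtain ⟨u, huv, hu0, m, hm⟩ := EllOne.exists_finite_support_near v (half_pos hε)
  obtain ⟨x₁, hx₁, h1, N, hN⟩ := exists_eventually_smallCoord hx (half_pos hε)
  obtain ⟨x₂, hx₂, h2, k, hk⟩ := exists_near_of_finite_support hx₁ hN hu0 hm (half_pos hε)
  refine ⟨x₂, hx₂, ?_, k, ?_⟩
  · linarith [norm_sub_le_norm_sub_add_norm_sub x₂ x₁ x]
  · linarith [norm_sub_le_norm_sub_add_norm_sub ((k ! : 𝕜) ^ 11 • (weightedShift 𝕜 ^ k) x₂) u v]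

/-- Some `x` in the growth set has a dense orbit under the operators `(k!)¹¹ B_ω ^ k`. -/
theorem exists_mem_growthSet_dense (𝕜 : Type*) [RCLike 𝕜] : ∃ x ∈ growthSet 𝕜,
    Dense (Set.range fun k : ℕ => (k ! : 𝕜) ^ 11 • (weightedShift 𝕜 ^ k) x) := by
  -- Baire is applied in `growthSet`; a point of all the `U p` comes within every `1 / (n + 1)` of
  -- each term of a dense sequence.
  have : CompleteSpace (growthSet 𝕜) := isClosed_growthSet.completeSpace_coe
  have : Nonempty (growthSet 𝕜) := growthSet_nonempty.to_subtype
  let D := TopologicalSpace.denseSeq (EllOne 𝕜)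
  let U : ℕ × ℕ → Set (growthSet 𝕜) := fun p =>
    ⋃ k : ℕ, {x | ‖(k ! : 𝕜) ^ 11 • (weightedShift 𝕜 ^ k) (x : EllOne 𝕜) - D p.1‖ <
      1 / ((p.2 : ℝ) + 1)}
  have hopen : ∀ p, IsOpen (U p) := fun p => isOpen_iUnion fun k =>
    isOpen_lt (by fun_prop) continuous_const
  have hdense : ∀ p, Dense (U p) := fun p => by
    rw [Metric.dense_iff]
    intro x r hr
    obtain ⟨x', hx', h1, k, hk⟩ := exists_near x.2 (D p.1)
      (lt_min hr (Nat.one_div_pos_of_nat (α := ℝ) (n := p.2)))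
    refine ⟨⟨x', hx'⟩, ?_, Set.mem_iUnion.2 ⟨k, hk.trans_le (min_le_right _ _)⟩⟩
    rw [Metric.mem_ball, Subtype.dist_eq, dist_eq_norm]
    exact h1.trans_le (min_le_left _ _)
  obtain ⟨x, hx⟩ := (dense_iInter_of_isOpen hopen hdense).nonempty
  refine ⟨x, x.2, ?_⟩
  have hD : Set.range D ⊆
      closure (Set.range fun k : ℕ => (k ! : 𝕜) ^ 11 • (weightedShift 𝕜 ^ k) (x : EllOne 𝕜)) := by
    rintro _ ⟨i, rfl⟩
    rw [Metric.mem_closure_range_iff]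
    intro ε hε
    obtain ⟨n, hn⟩ := exists_nat_one_div_lt hε
    obtain ⟨k, hk⟩ := Set.mem_iUnion.1 (Set.mem_iInter.1 hx (i, n))
    refine ⟨k, ?_⟩
    rw [dist_comm, dist_eq_norm]
    exact lt_trans hk hn
  exact dense_closure.1 ((TopologicalSpace.denseRange_denseSeq (EllOne 𝕜)).mono hD)

/-- The growth bound leaves `(k + 1) ^ 11 / k!`, and `(k + 1) ^ 11 ≤ 11! * e ^ (k + 1)` reduces this
to an exponential series. -/
theorem summable_growth_quotient {x : EllOne 𝕜} (hx : x ∈ growthSet 𝕜) :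
    Summable fun k : ℕ => ‖(k ! : 𝕜) ^ 2 * ((k : 𝕜) + 1) ^ 11 / coordProd x k‖ := by
  have hs := (Real.summable_pow_div_factorial (Real.exp 1)).mul_left (11 ! * Real.exp 1)
  refine EllOne.summable_norm_of_eventually_le hs 0 fun k _ => ?_
  have h1 := one_le_factorial_cast k
  have h2 : ((k : ℝ) + 1) ^ 11 ≤ 11 ! * Real.exp 1 * Real.exp 1 ^ k := by
    have := Real.pow_div_factorial_le_exp ((k : ℝ) + 1) (by positivity) 11
    rw [div_le_iff₀ (by positivity), Real.exp_add, ← Real.exp_one_pow] at this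
    linarith
  have h3 : ‖(k : 𝕜) + 1‖ = (k : ℝ) + 1 := by
    simpa using RCLike.norm_natCast (K := 𝕜) (k + 1)
  rw [norm_div, norm_mul, norm_pow, norm_pow, RCLike.norm_natCast, h3, ← mul_div_assoc]
  calc (k ! : ℝ) ^ 2 * ((k : ℝ) + 1) ^ 11 / ‖coordProd x k‖
      ≤ (k ! : ℝ) ^ 2 * (11 ! * Real.exp 1 * Real.exp 1 ^ k) / (k ! : ℝ) ^ 3 := by
        gcongr
        exact hx k
    _ = 11 ! * Real.exp 1 * Real.exp 1 ^ k / k ! := by field_simp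

end Density

end

theorem mainTheorem4 (𝕜 : Type*) [RCLike 𝕜] : IsBilinearHypercyclic (shiftBilinear 𝕜) := by
  obtain ⟨x, hx, hd⟩ := exists_mem_growthSet_dense 𝕜
  refine ⟨x, EllOne.ofSummable _ (summable_growth_quotient hx), hd.mono ?_⟩
  rintro _ ⟨k, rfl⟩
  exact ⟨2 * k, (bilinearOrbit_shiftBilinear (coordProd_ne_zero hx) (fun _ => rfl) k).1⟩
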